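/- Preferential attachment process. For parameter $1$, let $G_1^1$ be one vertex $u_1$ with one loop; for $k \ge 2$, $G_1^k$ arises from $G_1^{k-1}$ by adding a vertex $u_k$ and one edge from $u_k$ to $u_i$, where, given the past, $i = s$ with probability $\frac{\deg(u_s)}{2k-1}$ for $1 \le s \le k-1$ ($\deg$ being the degree in $G_1^{k-1}$) and $i = k$ with probability $\frac{1}{2k-1}$. A loop contributes $2$ to the degree. For an integer $m \ge 1$, the multigraph $G_m^n$ with vertices $v_1,\dots,v_n$ is obtained from $G_1^{mn}$ by merging $u_{(i-1)m+1},\dots,u_{im}$ into $v_i$ for each $i$, keeping all edges, so that all the graphs $G_m^1, G_m^2, \dots$ live on one probability space. For a set $S$ of vertices of $G_m^t$ and $n \ge t$, let $d_m^n(S)$ be the sum of the degrees in $G_m^n$ of the vertices in $S$. Theorem. There is an absolute constant $C$ such that the following holds. Let $0 < \varepsilon \le 1/40$, let $t, m \ge 1$ be integers with $t > \varepsilon^{-6}$, let $S \subseteq \{v_1,\dots,v_t\}$, and let $d$ be a value that $d_m^t(S)$ takes with positive probability. Then $$\mathbb{P}\Bigl[ (1-\varepsilon)\sqrt{\tfrac{n}{t}}\;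 d_m^t(S) < d_m^n(S) < (1+\varepsilon)\sqrt{\tfrac{n}{t}}\; d_m^t(S) \text{ for all } n \ge t \Bigm| d_m^t(S) = d \Bigr] \;\ge\; 1 - \ln(15t)\, e^{-\varepsilon^{C} d}.$$ -/

import Mathlib

open MeasureTheory ProbabilityTheory
open scoped ENNReal

namespace PrefAttach

/-- A finite multigraph (parallel edges and loops allowed) with vertex type `V`, given by the
multiset of its edges. An edge is written as a pair of end points; `degree` ignores the order
of the two entries. -/
structure Multigraph (V : Type) where
  edges : Multiset (V × V)

/-- The degree of `v`: the number of edge ends at `v`; a loop counts twice. -/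
def Multigraph.degree {V : Type} [DecidableEq V] (G : Multigraph V) (v : V) : ℕ :=
  (G.edges.map Prod.fst).count v + (G.edges.map Prod.snd).count v

/-- The degree of a set of vertices: the sum of the degrees of its members. -/
def Multigraph.setDegree {V : Type} [DecidableEq V] (G : Multigraph V) (S : Finset V) : ℕ :=
  ∑ v ∈ S, G.degree v

/-- Merge vertices along `f : V → W`: all the vertices in a fibre of `f` become one vertex, and
every edge is kept (edges inside a fibre become loops). -/
def Multigraph.merge {V W : Type} (G : Multigraph V) (f : V → W) : Multigraph W where
  edges := G.edges.map (Prod.map f f)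

/-- The graph on the vertices `0, …, n - 1` in which vertex `i` brings one edge, from `i` to
the vertex `c i ∈ {0, …, i}`. (Vertex `i` here is the `(i+1)`-st vertex to arrive.) -/
def graphOfChoices (n : ℕ) (c : (i : Fin n) → Fin (i.val + 1)) : Multigraph (Fin n) where
  edges := (Finset.univ : Finset (Fin n)).val.map
    (fun i => (i, Fin.castLE (Nat.succ_le_of_lt i.isLt) (c i)))

/-- The probability that the vertex joining a graph with `n` vertices (so, the vertex number
`t = n + 1`, with `2 t - 1 = 2 n + 1`) sends its edge to vertex `s`: proportional to the degree
for the old vertices `s < n`, and with weight one for the new vertex itself. -/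
noncomputable def attachProb {n : ℕ} (G : Multigraph (Fin n)) (s : Fin (n + 1)) : ℝ≥0∞ :=
  if h : s.val < n then (G.degree ⟨s.val, h⟩ : ℝ≥0∞) / (2 * n + 1) else 1 / (2 * n + 1)

lemma sum_degree_graphOfChoices (n : ℕ) (c : (i : Fin n) → Fin (i.val + 1)) :
    ∑ v, (graphOfChoices n c).degree v = 2 * n := by
  simp only [Multigraph.degree, Finset.sum_add_distrib]
  rw [Multiset.sum_count_eq_card (by simp), Multiset.sum_count_eq_card (by simp)]
  simp [graphOfChoices, two_mul]

lemma sum_attachProb (n : ℕ) (c : (i : Fin n) → Fin (i.val + 1)) :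
    ∑ s, attachProb (graphOfChoices n c) s = 1 := by
  rw [Fin.sum_univ_castSucc]
  simp only [attachProb, Fin.val_castSucc, Fin.is_lt, dite_true, Fin.eta, Fin.val_last,
    lt_irrefl, dite_false]
  simp only [div_eq_mul_inv]
  rw [← Finset.sum_mul, ← Nat.cast_sum, sum_degree_graphOfChoices, ← add_mul]
  push_cast
  refine ENNReal.mul_inv_cancel (by simp) ?_
  exact_mod_cast ENNReal.natCast_ne_top (2 * n + 1)

/-- The law of the vertex chosen by the newcomer, given the choices of the first `n` vertices. -/
noncomputable def attachPMF (n : ℕ) (c : (i : Fin n) → Fin (i.val + 1)) : PMF (Fin (n + 1)) :=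
  PMF.ofFintype (attachProb (graphOfChoices n c)) (sum_attachProb n c)

/-- The choices made by all the vertices: vertex `i` chooses `ω i ∈ {0, …, i}`. -/
abbrev Choices : Type := (i : ℕ) → Fin (i + 1)

/-- A history of the choices made by the vertices `0, …, k`. -/
abbrev History (k : ℕ) : Type := (i : Finset.Iic k) → Fin (i.val + 1)

/-- The transition kernel of the process: from the choices of the vertices `0, …, k` to the
choice of vertex `k + 1`. -/
noncomputable def step (k : ℕ) : Kernel (History k) (Fin (k + 1 + 1)) where
  toFun x := (attachPMF (k + 1)
    (fun i => x ⟨i.val, Finset.mem_Iic.2 (Nat.le_of_lt_succ i.isLt)⟩)).toMeasure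
  measurable' := measurable_of_countable _

instance (k : ℕ) : IsMarkovKernel (step k) :=
  ⟨fun _ => PMF.toMeasure.isProbabilityMeasure _⟩

/-- The law of the preferential attachment process: vertex `0` starts with a loop, and every
later vertex chooses its neighbour according to `step`. -/
noncomputable def law : Measure Choices :=
  Kernel.traj (X := fun i : ℕ => Fin (i + 1)) step 0 (fun _ => 0)

instance : IsProbabilityMeasure law := by unfold law; infer_instance

/-- The graph of the process with parameter `1` at time `n`. -/
def graphOne (n : ℕ) (ω : Choices) : Multigraph (Fin n) :=
  graphOfChoices n (fun i => ω i.val)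

/-- The graph of the process with parameter `m` at time `n`: in the graph with parameter `1` at
time `n * m`, the vertices `m i, …, m i + m - 1` are merged into vertex `i`. -/
def graph (m n : ℕ) (ω : Choices) : Multigraph (Fin n) :=
  (graphOne (n * m) ω).merge Fin.divNat

/-- For a set `S` of vertices among the first `t`, the degree of `S` at time `n ≥ t` in the
process with parameter `m`. -/
def deg (m : ℕ) {t : ℕ} (S : Finset (Fin t)) (n : ℕ) (h : t ≤ n) (ω : Choices) : ℕ :=
  (graph m n ω).setDegree (S.map (Fin.castLEEmb h))

end PrefAttach

namespace PrefAttach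

/-! Merging keeps edge ends, so everything reduces to parameter 1: with `M = t * m`, the end count
`Y k` of a set of vertices below `M` rises by 1 with probability `Y k / (2k+1)`. Hence `decay M k *
Y k` is a martingale, and `decay M k` is close to `√(M/k)`. Adding a quadratic correction to the
exponent (`tilt`) makes `exp (tilt l (decay M k) * Y k)` a supermartingale for small `l` of either
sign. Ville's inequality (`mul_law_exists_le`) controls it at all times at once, so no union bound
over `n` is needed; one positive and one negative `l` give the two tails. -/

/-! ### Set degrees as counts of edge ends -/

lemma Multigraph.setDegree_eq_sum {V : Type} [DecidableEq V] (G : Multigraph V) (S : Finset V) :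
    G.setDegree S = (G.edges.map
      (fun e => (if e.1 ∈ S then 1 else 0) + (if e.2 ∈ S then 1 else 0))).sum := by
  obtain ⟨E⟩ := G
  simp only [Multigraph.setDegree, Multigraph.degree]
  induction E using Multiset.induction with
  | empty => simp
  | cons e E ih =>
    simp only [Multiset.map_cons, Multiset.count_cons, Multiset.sum_cons, ← ih,
      Finset.sum_add_distrib, Finset.sum_ite_eq']
    ring

/-- The number of ends, among the edges brought by the vertices `0, …, n - 1`, that lie in `T`. -/
def endCount (T : Finset ℕ) (n : ℕ) (ω : Choices) : ℕ :=
  ∑ i ∈ Finset.range n, ((if i ∈ T then 1 else 0) + (if (ω i).val ∈ T then 1 else 0))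

lemma endCount_succ {T : Finset ℕ} {n : ℕ} (hn : n ∉ T) (ω : Choices) :
    endCount T (n + 1) ω = endCount T n ω + if (ω n).val ∈ T then 1 else 0 := by
  simp [endCount, Finset.sum_range_succ, hn]

lemma endCount_le (T : Finset ℕ) (n : ℕ) (ω : Choices) : endCount T n ω ≤ 2 * n := by
  have : endCount T n ω ≤ ∑ i ∈ Finset.range n, 2 :=
    Finset.sum_le_sum fun i _ => by split_ifs <;> norm_num
  simpa [mul_comm] using this

lemma dependsOn_endCount (T : Finset ℕ) (n : ℕ) : DependsOn (endCount T n) (Set.Iio n) := by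
  intro x y h
  refine Finset.sum_congr rfl fun i hi => ?_
  rw [h i (Finset.mem_range.1 hi)]

lemma setDegree_graphOne (T : Finset ℕ) (n : ℕ) (ω : Choices) :
    (graphOne n ω).setDegree (Finset.univ.filter fun i : Fin n => i.val ∈ T) =
      endCount T n ω := by
  rw [Multigraph.setDegree_eq_sum, endCount, Finset.sum_range]
  simp only [graphOne, graphOfChoices, Multiset.map_map, Function.comp_def, Finset.mem_filter,
    Finset.mem_univ, true_and]
  rfl

/-- The vertices of the process with parameter `1` that are merged into a member of `S`. -/
def mergedInto (m : ℕ) {t : ℕ} (S : Finset (Fin t)) : Finset ℕ :=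
  (Finset.range (t * m)).filter fun i => i / m ∈ S.map Fin.valEmbedding

lemma deg_eq_endCount {m t : ℕ} (S : Finset (Fin t)) {n : ℕ} (h : t ≤ n) (ω : Choices) :
    deg m S n h ω = endCount (mergedInto m S) (n * m) ω := by
  have key : ∀ i : Fin (n * m),
      (i.divNat ∈ S.map (Fin.castLEEmb h)) ↔ i.val ∈ mergedInto m S := by
    intro i
    have hm : 0 < m := Nat.pos_of_mul_pos_left i.pos
    simp only [mergedInto, Finset.mem_map, Finset.mem_filter, Finset.mem_range]
    constructor
    · rintro ⟨v, hv, e⟩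
      have e' : v.val = i.val / m := by simpa using congrArg Fin.val e
      refine ⟨(Nat.div_lt_iff_lt_mul hm).1 (e' ▸ v.isLt), v, hv, e'⟩
    · rintro ⟨_, v, hv, e⟩
      exact ⟨v, hv, Fin.ext (by simpa using e)⟩
  rw [deg, Multigraph.setDegree_eq_sum, endCount, Finset.sum_range]
  simp only [graph, graphOne, graphOfChoices, Multigraph.merge, Multiset.map_map,
    Function.comp_def, Prod.map, key]
  rfl

/-! ### One-step transition of the end count -/

lemma sum_attachProb_mem {T : Finset ℕ} {n : ℕ} (hn : n ∉ T) (ω : Choices) :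
    ∑ s : Fin (n + 1), (if s.val ∈ T then attachProb (graphOne n ω) s else 0) =
      (endCount T n ω : ℝ≥0∞) / (2 * n + 1) := by
  rw [Fin.sum_univ_castSucc]
  simp only [attachProb, Fin.val_castSucc, Fin.is_lt, dite_true, Fin.eta, Fin.val_last, hn,
    if_false, add_zero]
  rw [← setDegree_graphOne, Multigraph.setDegree, Finset.sum_filter, div_eq_mul_inv,
    Nat.cast_sum, Finset.sum_mul]
  refine Finset.sum_congr rfl fun i _ => ?_
  split_ifs <;> simp [div_eq_mul_inv]

lemma sum_attachProb_notMem {T : Finset ℕ} {n : ℕ} (hn : n ∉ T) (ω : Choices) :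
    ∑ s : Fin (n + 1), (if s.val ∈ T then 0 else attachProb (graphOne n ω) s) =
      1 - (endCount T n ω : ℝ≥0∞) / (2 * n + 1) := by
  rw [← sum_attachProb_mem hn]
  refine ENNReal.eq_sub_of_add_eq ?_ ?_
  · rw [sum_attachProb_mem hn]
    refine ENNReal.div_ne_top (ENNReal.natCast_ne_top _) (by simp)
  · rw [← Finset.sum_add_distrib, ← sum_attachProb n (fun i => ω i.val)]
    refine Finset.sum_congr rfl fun i _ => ?_
    split_ifs <;> simp [graphOne]

/-- Extend a history by an arbitrary future. -/
def History.extend {k : ℕ} (x : History k) : Choices :=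
  fun i => if h : i ≤ k then x ⟨i, Finset.mem_Iic.2 h⟩ else 0

/-- Lets functions of the past be read on the countable type of histories, where measurability is
free. -/
lemma History.extend_frestrictLe {α : Type*} {k : ℕ} {g : Choices → α}
    (hg : DependsOn g (Set.Iio (k + 1))) (ω : Choices) :
    g (History.extend (k := k) (Preorder.frestrictLe k ω)) = g ω := by
  refine hg fun i hi => ?_
  have : i ≤ k := Nat.lt_succ_iff.1 hi
  simp [History.extend, this]

lemma lintegral_law_succ (k : ℕ) (f : History k → Fin (k + 2) → ℝ≥0∞) :
    ∫⁻ ω, f (Preorder.frestrictLe k ω) (ω (k + 1)) ∂law =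
      ∫⁻ ω, ∑ s, f (Preorder.frestrictLe k ω) s * attachProb (graphOne (k + 1) ω) s ∂law := by
  have hf : Measurable (Function.uncurry f) := measurable_of_countable _
  have h1 := Kernel.partialTraj_compProd_eq_map_traj (X := fun i : ℕ => Fin (i + 1)) (κ := step)
    (Nat.zero_le k) (x₀ := fun _ => 0)
  have h2 : ∫⁻ ω, f (Preorder.frestrictLe k ω) (ω (k + 1)) ∂law =
      ∫⁻ p, Function.uncurry f p ∂(law.map
        (fun x => (Preorder.frestrictLe k x, x (k + 1)))) := by
    rw [lintegral_map hf (by fun_prop)]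
    rfl
  rw [h2, law, ← h1, Measure.lintegral_compProd hf,
    ← Kernel.traj_map_frestrictLe_apply, lintegral_map (measurable_of_countable _) (by fun_prop)]
  refine lintegral_congr fun ω => ?_
  rw [lintegral_fintype]
  refine Finset.sum_congr rfl fun s _ => ?_
  congr 1
  simp only [step, Kernel.coe_mk]
  rw [PMF.toMeasure_apply_singleton _ _ (measurableSet_singleton s)]
  rfl

lemma measurable_of_dependsOn {α : Type*} [MeasurableSpace α] {n : ℕ} {g : Choices → α}
    (hg : DependsOn g (Set.Iio (n + 1))) : Measurable g := by
  have : g = (fun x : History n => g x.extend) ∘ Preorder.frestrictLe n := by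
    funext ω
    exact (History.extend_frestrictLe hg ω).symm
  rw [this]
  exact (measurable_of_countable _).comp (by fun_prop)

lemma setLIntegral_endCount_succ {T : Finset ℕ} {k : ℕ} (hk : k + 1 ∉ T) {B : Set Choices}
    (hB : DependsOn (· ∈ B) (Set.Iio (k + 1))) (w : ℕ → ℝ≥0∞) :
    ∫⁻ ω in B, w (endCount T (k + 2) ω) ∂law =
      ∫⁻ ω in B, (w (endCount T (k + 1) ω + 1) *
          ((endCount T (k + 1) ω : ℝ≥0∞) / (2 * (k + 1 : ℕ) + 1)) +
        w (endCount T (k + 1) ω) *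
          (1 - (endCount T (k + 1) ω : ℝ≥0∞) / (2 * (k + 1 : ℕ) + 1))) ∂law := by
  classical
  have mB : MeasurableSet B := measurableSet_setOfPred.2 (measurable_of_dependsOn hB)
  rw [← lintegral_indicator mB, ← lintegral_indicator mB]
  have hB' := fun ω => History.extend_frestrictLe hB ω
  have hY' := fun ω => History.extend_frestrictLe (dependsOn_endCount T (k + 1)) ω
  have := lintegral_law_succ k (fun x s => if x.extend ∈ B then
    w (endCount T (k + 1) x.extend + if s.val ∈ T then 1 else 0) else 0)
  simp only [hB', hY'] at this
  convert this using 1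
  · refine lintegral_congr fun ω => ?_
    simp only [Set.indicator_apply, endCount_succ hk]
  · refine lintegral_congr fun ω => ?_
    simp only [Set.indicator_apply]
    split_ifs with h
    · rw [← sum_attachProb_notMem hk, ← sum_attachProb_mem hk, Finset.mul_sum, Finset.mul_sum,
        ← Finset.sum_add_distrib]
      refine Finset.sum_congr rfl fun s _ => ?_
      split_ifs <;> simp
    · simp

/-! ### Maximal inequality -/

/-- A maximal inequality of Ville's type for the number of edge ends. -/
lemma mul_law_exists_le {T : Finset ℕ} {M : ℕ} (hM : 1 ≤ M) (hT : ∀ i ∈ T, i < M)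
    {A : Set Choices} (hA : DependsOn (· ∈ A) (Set.Iio M)) (w : ℕ → ℕ → ℝ≥0∞) (c : ℝ≥0∞)
    (hw : ∀ k, M ≤ k → ∀ y : ℕ, y ≤ 2 * k →
      w (k + 1) (y + 1) * ((y : ℝ≥0∞) / (2 * k + 1)) +
        w (k + 1) y * (1 - (y : ℝ≥0∞) / (2 * k + 1)) ≤ w k y) :
    c * law {ω | ω ∈ A ∧ ∃ k, M ≤ k ∧ c ≤ w k (endCount T k ω)} ≤
      ∫⁻ ω in A, w M (endCount T M ω) ∂law := by
  classical
  set H : ℕ → Set Choices :=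
    fun N => {ω | ω ∈ A ∧ ∃ k, M ≤ k ∧ k ≤ N ∧ c ≤ w k (endCount T k ω)} with hH
  have depH : ∀ N, M ≤ N → DependsOn (· ∈ H N) (Set.Iio N) := by
    intro N hN x y hxy
    have h1 : (x ∈ A) = (y ∈ A) := hA fun i hi => hxy i (lt_of_lt_of_le hi hN)
    have h2 : ∀ k ≤ N, endCount T k x = endCount T k y := fun k hk =>
      dependsOn_endCount T k fun i hi => hxy i (lt_of_lt_of_le hi hk)
    simp only [hH, Set.mem_ofPred_eq, h1]
    refine propext (and_congr_right fun _ => exists_congr fun k => and_congr_right fun _ =>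
      and_congr_right fun hk => ?_)
    rw [h2 k hk]
  have meas : ∀ {B : Set Choices} {N : ℕ}, M ≤ N → DependsOn (· ∈ B) (Set.Iio N) →
      MeasurableSet B := by
    intro B N hN hB
    obtain ⟨k, rfl⟩ : ∃ k, N = k + 1 := ⟨N - 1, by omega⟩
    exact measurableSet_setOfPred.2 (measurable_of_dependsOn hB)
  have measw : ∀ N, M ≤ N → ∀ f : ℕ → ℝ≥0∞, Measurable fun ω => f (endCount T N ω) := by
    intro N hN f
    obtain ⟨k, rfl⟩ : ∃ k, N = k + 1 := ⟨N - 1, by omega⟩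
    exact (measurable_of_countable f).comp (measurable_of_dependsOn (dependsOn_endCount T _))
  have mA : MeasurableSet A := meas le_rfl hA
  have depD : ∀ N, M ≤ N → DependsOn (· ∈ A \ H N) (Set.Iio N) := by
    intro N hN x y hxy
    have h1 : (x ∈ A) = (y ∈ A) := hA fun i hi => hxy i (lt_of_lt_of_le hi hN)
    have h2 : (x ∈ H N) = (y ∈ H N) := depH N hN hxy
    simp only [Set.mem_sdiff, h1, h2]
  have monoH : ∀ N, H N ⊆ H (N + 1) := fun N ω ⟨h, k, h1, h2, h3⟩ =>
    ⟨h, k, h1, by omega, h3⟩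
  -- Optional stopping by hand: paths that have crossed level `c` are charged `c`, the others keep
  -- their current weight.
  have bound : ∀ N, M ≤ N → c * law (H N) + ∫⁻ ω in A \ H N, w N (endCount T N ω) ∂law ≤
      ∫⁻ ω in A, w M (endCount T M ω) ∂law := by
    have split : ∀ (B : Set Choices) (N : ℕ), M ≤ N → MeasurableSet B →
        (∀ ω ∈ B, ω ∈ H N → c ≤ w N (endCount T N ω)) →
        c * law (B ∩ H N) + ∫⁻ ω in B \ H N, w N (endCount T N ω) ∂law ≤
        ∫⁻ ω in B, w N (endCount T N ω) ∂law := by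
      intro B N hN mB h
      have mH : MeasurableSet (H N) := meas hN (depH N hN)
      rw [← lintegral_inter_add_sdiff (μ := law) _ B mH]
      gcongr
      rw [← setLIntegral_const]
      exact setLIntegral_mono (measw N hN (w N)) fun ω hω => h ω hω.1 hω.2
    intro N hN
    induction N, hN using Nat.le_induction with
    | base =>
      have hsub : H M ⊆ A := fun ω h => h.1
      have := split A M le_rfl mA (by
        rintro ω _ ⟨_, k, h1, h2, h3⟩
        obtain rfl : k = M := le_antisymm h2 h1
        exact h3)
      rwa [Set.inter_eq_right.2 hsub] at this
    | succ N hN ih =>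
      refine le_trans ?_ ih
      have hD : MeasurableSet (A \ H N) := meas hN (depD N hN)
      have h1 := split (A \ H N) (N + 1) (by omega) hD (by
        rintro ω ⟨_, hn⟩ ⟨hA, k, h1, h2, h3⟩
        rcases Nat.lt_or_ge N k with h | h
        · obtain rfl : k = N + 1 := by omega
          exact h3
        · exact absurd ⟨hA, k, h1, h, h3⟩ hn)
      have e1 : (A \ H N) \ H (N + 1) = A \ H (N + 1) := by
        ext ω
        simp only [Set.mem_sdiff]
        exact ⟨fun h => ⟨h.1.1, h.2⟩, fun h => ⟨⟨h.1, fun h' => h.2 (monoH N h')⟩, h.2⟩⟩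
      have e2 : law (H (N + 1)) = law (H N) + law ((A \ H N) ∩ H (N + 1)) := by
        rw [← measure_union _ (hD.inter (meas (by omega) (depH (N + 1) (by omega))))]
        · congr 1
          ext ω
          by_cases h : ω ∈ H N
          · simp [h, monoH N h]
          · simp only [Set.mem_union, h, false_or, Set.mem_inter_iff, Set.mem_sdiff,
              not_false_eq_true, and_true]
            exact ⟨fun h' => ⟨h'.1, h'⟩, fun h' => h'.2⟩
        · exact Set.disjoint_left.2 fun ω h h' => h'.1.2 h
      have h3 : ∫⁻ ω in A \ H N, w (N + 1) (endCount T (N + 1) ω) ∂law ≤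
          ∫⁻ ω in A \ H N, w N (endCount T N ω) ∂law := by
        obtain ⟨k, rfl⟩ : ∃ k, N = k + 1 := ⟨N - 1, by omega⟩
        rw [setLIntegral_endCount_succ (fun h => absurd (hT _ h) (by omega)) (depD _ hN)]
        exact lintegral_mono fun ω => hw _ hN _ (endCount_le _ _ _)
      rw [e1] at h1
      calc c * law (H (N + 1)) + ∫⁻ ω in A \ H (N + 1), w (N + 1) (endCount T (N + 1) ω) ∂law
          = c * law (H N) + (c * law ((A \ H N) ∩ H (N + 1)) +
            ∫⁻ ω in A \ H (N + 1), w (N + 1) (endCount T (N + 1) ω) ∂law) := by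
              rw [e2, mul_add, add_assoc]
        _ ≤ c * law (H N) + ∫⁻ ω in A \ H N, w N (endCount T N ω) ∂law := by
              gcongr
              exact h1.trans h3
  have hU : {ω | ω ∈ A ∧ ∃ k, M ≤ k ∧ c ≤ w k (endCount T k ω)} = ⋃ N, H (M + N) := by
    ext ω
    simp only [hH, Set.mem_ofPred_eq, Set.mem_iUnion]
    constructor
    · rintro ⟨h, k, h1, h2⟩
      exact ⟨k, h, k, h1, by omega, h2⟩
    · rintro ⟨N, h, k, h1, _, h2⟩
      exact ⟨h, k, h1, h2⟩
  rw [hU, (monotone_nat_of_le_succ fun N => monoH (M + N)).measure_iUnion, ENNReal.mul_iSup]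
  exact iSup_le fun N => le_self_add.trans (bound (M + N) (by omega))

/-! ### Growth factor -/

/-- The inverse of the mean growth factor of the degree of a set between the times `M` and `k`. -/
noncomputable def decay (M k : ℕ) : ℝ := ∏ j ∈ Finset.Ioc M k, (2 * j - 1 : ℝ) / (2 * j)

lemma decay_self (M : ℕ) : decay M M = 1 := by simp [decay]

lemma decay_succ {M k : ℕ} (h : M ≤ k) :
    decay M (k + 1) = decay M k * ((2 * k + 1) / (2 * k + 2)) := by
  rw [decay, Finset.prod_Ioc_succ_top h, decay]
  push_cast
  congr 2 <;> ring

lemma decay_pos {M k : ℕ} (h : M ≤ k) : 0 < decay M k := by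
  induction k, h using Nat.le_induction with
  | base => simp [decay_self]
  | succ k h ih => rw [decay_succ h]; positivity

lemma decay_le_one {M k : ℕ} (h : M ≤ k) : decay M k ≤ 1 := by
  induction k, h using Nat.le_induction with
  | base => simp [decay_self]
  | succ k h ih =>
    rw [decay_succ h]
    refine mul_le_one₀ ih (by positivity) ?_
    rw [div_le_one (by positivity)]
    linarith

/-- The right side is nondecreasing in `k`, because `4k(k+1) ≤ (2k+1)²`. -/
lemma le_decay_sq_mul {M k : ℕ} (h : M ≤ k) : (M : ℝ) ≤ decay M k ^ 2 * k := by
  induction k, h using Nat.le_induction with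
  | base => simp [decay_self]
  | succ k h ih =>
    rw [decay_succ h]
    refine ih.trans ?_
    push_cast
    rw [mul_pow, mul_assoc]
    gcongr
    rw [div_pow, div_mul_eq_mul_div, le_div_iff₀ (by positivity)]
    nlinarith

/-- The left side is nonincreasing in `k`, because `(2k+1)(2k+3) ≤ (2k+2)²`. -/
lemma decay_sq_mul_le {M k : ℕ} (h : M ≤ k) : decay M k ^ 2 * (2 * k + 1) ≤ 2 * M + 1 := by
  induction k, h using Nat.le_induction with
  | base => simp [decay_self]
  | succ k h ih =>
    rw [decay_succ h]
    refine le_trans ?_ ih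
    push_cast
    rw [mul_pow, mul_assoc]
    gcongr
    have hk : (0 : ℝ) ≤ k := k.cast_nonneg
    rw [div_pow, div_mul_eq_mul_div, div_le_iff₀ (by positivity)]
    nlinarith [mul_nonneg hk hk]

/-! ### Exponential supermartingale -/

/-- The exponents for which the exponential of the degree is a supermartingale, as a function of
`u = decay M k`. -/
noncomputable def tilt (l u : ℝ) : ℝ := l * u + 2 * l ^ 2 * u ^ 2

lemma tilt_add_exp_sub_one_div_le {l u n : ℝ} (hl : |l| ≤ 1 / 5) (hu : 0 ≤ u) (hu1 : u ≤ 1)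
    (hn : 0 < n) :
    tilt l (u * (n / (n + 1))) + (Real.exp (tilt l (u * (n / (n + 1)))) - 1) / n ≤ tilt l u := by
  obtain ⟨v, hv⟩ : ∃ v, v = u * (n / (n + 1)) := ⟨_, rfl⟩
  have huv : u = v * ((n + 1) / n) := by rw [hv]; field_simp
  have hv0 : 0 ≤ v := by rw [hv]; positivity
  have hvu : v ≤ u := by
    rw [hv]
    exact mul_le_of_le_one_right hu (by rw [div_le_one (by positivity)]; linarith)
  rw [← hv]
  obtain ⟨hl1, hl2⟩ := abs_le.1 hl
  have hsq : tilt l v ^ 2 ≤ 2 * l ^ 2 * (v * u) := by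
    have e : tilt l v ^ 2 = l ^ 2 * (v * v) * (1 + 2 * (l * v)) ^ 2 := by rw [tilt]; ring
    have hlv1 : l * v ≤ 1 / 5 := by nlinarith
    have hlv2 : -(1 / 5) ≤ l * v := by nlinarith
    have h2 : (1 + 2 * (l * v)) ^ 2 ≤ 2 := by nlinarith
    rw [e]
    calc l ^ 2 * (v * v) * (1 + 2 * (l * v)) ^ 2 ≤ l ^ 2 * (v * u) * 2 := by gcongr
      _ = _ := by ring
  have habs : |tilt l v| ≤ 1 := by
    rw [← sq_le_one_iff_abs_le_one]
    refine hsq.trans ?_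
    have h1 : l ^ 2 ≤ 1 / 25 := by nlinarith
    have h2 : v * u ≤ 1 := by nlinarith
    have h3 : 0 ≤ v * u := by positivity
    nlinarith [mul_le_mul h1 h2 h3 (by norm_num)]
  have hexp : Real.exp (tilt l v) - 1 ≤ tilt l v + tilt l v ^ 2 := by
    have := (abs_le.1 (Real.abs_exp_sub_one_sub_id_le habs)).2
    linarith
  -- The linear part balances exactly; the fall of the quadratic part from `u` to `v` pays for the
  -- error `tilt l v ^ 2` in the bound on `exp`.
  have hkey : tilt l v + (tilt l v + 2 * l ^ 2 * (v * u)) / n = tilt l u := by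
    rw [huv, tilt, tilt]
    field_simp
    ring
  rw [← hkey]
  gcongr
  linarith

/-- By `1 + x ≤ exp x` the Bernoulli moment generating function is at most an exponential linear in
`y`, so one condition on `s`, `s'` serves every `y`. -/
lemma exp_bernoulli_step_le {s s' n y : ℝ} (hy : 0 ≤ y)
    (h : s' + (Real.exp s' - 1) / n ≤ s) :
    Real.exp (s' * (y + 1)) * (y / n) + Real.exp (s' * y) * (1 - y / n) ≤ Real.exp (s * y) := by
  have e : Real.exp (s' * (y + 1)) * (y / n) + Real.exp (s' * y) * (1 - y / n) =
      Real.exp (s' * y) * ((y / n) * (Real.exp s' - 1) + 1) := by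
    rw [mul_add, Real.exp_add, mul_one]; ring
  rw [e]
  calc _ ≤ Real.exp (s' * y) * Real.exp ((y / n) * (Real.exp s' - 1)) := by
        gcongr; exact Real.add_one_le_exp _
    _ = Real.exp ((s' + (Real.exp s' - 1) / n) * y) := by rw [← Real.exp_add]; congr 1; ring
    _ ≤ _ := by gcongr

lemma law_exists_tilt_ge_le {T : Finset ℕ} {M : ℕ} (hM : 1 ≤ M) (hT : ∀ i ∈ T, i < M) (d : ℕ)
    {l : ℝ} (hl : |l| ≤ 1 / 5) (x : ℝ) :
    law.real {ω | endCount T M ω = d ∧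
        ∃ k, M ≤ k ∧ x ≤ tilt l (decay M k) * endCount T k ω} ≤
      Real.exp ((l + 2 * l ^ 2) * d - x) * law.real {ω | endCount T M ω = d} := by
  set A : Set Choices := {ω | endCount T M ω = d} with hA
  have depA : DependsOn (· ∈ A) (Set.Iio M) := by
    intro ω ω' h
    simp only [hA, Set.mem_ofPred_eq, dependsOn_endCount T M h]
  have mA : MeasurableSet A := by
    obtain ⟨k, rfl⟩ : ∃ k, M = k + 1 := ⟨M - 1, by omega⟩
    exact measurableSet_setOfPred.2 (measurable_of_dependsOn depA)
  have key := mul_law_exists_le hM hT depA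
    (fun k y => ENNReal.ofReal (Real.exp (tilt l (decay M k) * y))) (ENNReal.ofReal (Real.exp x))
    (by
      intro k hk y hy
      have hn : (0 : ℝ) < 2 * k + 1 := by positivity
      have hy' : (y : ℝ) ≤ 2 * k := by exact_mod_cast hy
      have h1 : (y : ℝ≥0∞) / (2 * k + 1) = ENNReal.ofReal ((y : ℝ) / (2 * k + 1)) := by
        rw [ENNReal.ofReal_div_of_pos hn, ENNReal.ofReal_natCast,
          show (2 * k + 1 : ℝ) = ((2 * k + 1 : ℕ) : ℝ) by push_cast; rfl, ENNReal.ofReal_natCast]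
        push_cast
        rfl
      have hp : (y : ℝ) / (2 * k + 1) ≤ 1 := by rw [div_le_one hn]; linarith
      rw [h1, ← ENNReal.ofReal_one, ← ENNReal.ofReal_sub _ (by positivity),
        ← ENNReal.ofReal_mul (by positivity), ← ENNReal.ofReal_mul (by positivity),
        ← ENNReal.ofReal_add (by positivity) (mul_nonneg (by positivity) (by linarith))]
      refine ENNReal.ofReal_le_ofReal ?_
      push_cast
      refine exp_bernoulli_step_le (by positivity) ?_
      have := tilt_add_exp_sub_one_div_le hl (decay_pos hk).le (decay_le_one hk) hn
      rwa [show (2 * k + 1 + 1 : ℝ) = 2 * k + 2 by ring, ← decay_succ hk] at this)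
  have hint : ∫⁻ ω in A, ENNReal.ofReal (Real.exp (tilt l (decay M M) * endCount T M ω)) ∂law =
      ENNReal.ofReal (Real.exp ((l + 2 * l ^ 2) * d)) * law A := by
    rw [← setLIntegral_const]
    refine setLIntegral_congr_fun mA fun ω hω => ?_
    have hω' : endCount T M ω = d := hω
    simp [hω', decay_self, tilt]
  rw [hint] at key
  have key' := ENNReal.toReal_mono
    (ENNReal.mul_ne_top ENNReal.ofReal_ne_top (measure_ne_top law A)) key
  rw [ENNReal.toReal_mul, ENNReal.toReal_mul, ENNReal.toReal_ofReal (by positivity),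
    ENNReal.toReal_ofReal (by positivity)] at key'
  simp only [ENNReal.ofReal_le_ofReal_iff (Real.exp_pos _).le, Real.exp_le_exp] at key'
  rw [Real.exp_sub, div_mul_eq_mul_div, le_div_iff₀ (Real.exp_pos _), mul_comm]
  exact key'

/-! ### Comparison with the square root -/

lemma one_le_decay_mul_sqrt {M k : ℕ} (hM : 1 ≤ M) (h : M ≤ k) :
    1 ≤ decay M k * Real.sqrt ((k : ℝ) / M) := by
  have hM' : (0 : ℝ) < M := by exact_mod_cast hM
  refine le_trans (le_abs_self _) (abs_le_of_sq_le_sq ?_ (mul_nonneg (decay_pos h).le (Real.sqrt_nonneg _)))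
  rw [mul_pow, Real.sq_sqrt (by positivity), one_pow, ← mul_div_assoc, le_div_iff₀ hM', one_mul]
  exact le_decay_sq_mul h

lemma decay_mul_sqrt_le {M k : ℕ} {ε : ℝ} (hM : 1 ≤ M) (h : M ≤ k) (hε : ε ≤ 1)
    (hMε : 1 ≤ ε * M) : (1 - ε) * (decay M k * Real.sqrt ((k : ℝ) / M)) ≤ 1 - ε / 2 := by
  have hM' : (0 : ℝ) < M := by exact_mod_cast hM
  have hε0 : 0 < ε := by
    by_contra h'
    nlinarith
  refine le_trans (le_abs_self _) (abs_le_of_sq_le_sq ?_ (by linarith))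
  rw [mul_pow, mul_pow, Real.sq_sqrt (by positivity), ← mul_div_assoc]
  -- The excess over 1 is at most `1/(2M)`, and `1/M ≤ ε`.
  have h1 : decay M k ^ 2 * k / M ≤ 1 + ε / 2 := by
    rw [div_le_iff₀ hM']
    nlinarith [decay_sq_mul_le h, sq_nonneg (decay M k)]
  calc (1 - ε) ^ 2 * (decay M k ^ 2 * k / M) ≤ (1 - ε) ^ 2 * (1 + ε / 2) := by gcongr
    _ ≤ _ := by
      nlinarith [mul_nonneg hε0.le hε0.le,
        mul_nonneg (mul_nonneg hε0.le hε0.le) (sub_nonneg.2 hε)]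

end PrefAttach

/-! ### The two tails and the conclusion -/

open PrefAttach in
theorem mainTheorem3 :
    ∃ C : ℕ, ∀ (ε : ℝ) (t m : ℕ) (S : Finset (Fin t)) (d : ℕ),
      0 < ε → ε ≤ 1 / 40 → 1 / ε ^ 6 < (t : ℝ) → 1 ≤ m →
      PrefAttach.law {ω | PrefAttach.deg m S t le_rfl ω = d} ≠ 0 →
      1 - Real.log (15 * (t : ℝ)) * Real.exp (-(ε ^ C * (d : ℝ))) ≤
        (ProbabilityTheory.cond PrefAttach.law
            {ω | PrefAttach.deg m S t le_rfl ω = d}).real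
          {ω | ∀ (n : ℕ) (h : t ≤ n),
            (1 - ε) * Real.sqrt ((n : ℝ) / (t : ℝ)) * (d : ℝ) < (PrefAttach.deg m S n h ω : ℝ) ∧
            (PrefAttach.deg m S n h ω : ℝ) < (1 + ε) * Real.sqrt ((n : ℝ) / (t : ℝ)) * (d : ℝ)} := by
  -- The tail exponents are `-ε²d/8` and `-ε²d/32`; both are at most `-ε³d` since `ε ≤ 1/40`.
  refine ⟨3, fun ε t m S d hε hε1 ht hm hA0 => ?_⟩
  have ht1 : 1 ≤ ε * t := by
    have h1 : 1 < t * ε ^ 6 := by rwa [div_lt_iff₀ (by positivity)] at ht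
    have h2 : ε ^ 6 ≤ ε := by
      simpa using pow_le_pow_of_le_one hε.le (by linarith) (show 1 ≤ 6 by norm_num)
    nlinarith [mul_le_mul_of_nonneg_left h2 (Nat.cast_nonneg (α := ℝ) t)]
  have ht0 : 1 ≤ t := by
    rcases Nat.eq_zero_or_pos t with rfl | h
    · norm_num at ht1
    · exact h
  have ht' : (1 : ℝ) ≤ t := by exact_mod_cast ht0
  have hm' : (1 : ℝ) ≤ m := by exact_mod_cast hm
  set T := mergedInto m S with hTdef
  obtain ⟨M, hM⟩ : ∃ M, M = t * m := ⟨_, rfl⟩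
  have hM1 : 1 ≤ M := hM ▸ Nat.mul_pos ht0 hm
  have hMε : 1 ≤ ε * M := by
    rw [hM]; push_cast
    nlinarith [mul_le_mul_of_nonneg_left hm' (by positivity : 0 ≤ ε * t)]
  have hT : ∀ i ∈ T, i < M := fun i hi => by
    rw [hM]
    exact Finset.mem_range.1 (Finset.mem_filter.1 hi).1
  simp only [deg_eq_endCount, ← hTdef, ← hM] at hA0 ⊢
  set A : Set Choices := {ω | endCount T M ω = d} with hA
  set G : Set Choices := {ω | ∀ n : ℕ, t ≤ n →
    (1 - ε) * Real.sqrt ((n : ℝ) / (t : ℝ)) * (d : ℝ) < (endCount T (n * m) ω : ℝ) ∧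
    (endCount T (n * m) ω : ℝ) < (1 + ε) * Real.sqrt ((n : ℝ) / (t : ℝ)) * (d : ℝ)} with hG
  set U : Set Choices := {ω | endCount T M ω = d ∧
    ∃ k, M ≤ k ∧ ε / 4 * ((1 + ε) * d) ≤ tilt (ε / 4) (decay M k) * endCount T k ω} with hU
  -- Half of the margin `ε` is given up to the discrepancy between `decay` and the square root.
  set L : Set Choices := {ω | endCount T M ω = d ∧
    ∃ k, M ≤ k ∧ -(ε / 8) * ((1 - ε / 2) * d) ≤
      tilt (-(ε / 8)) (decay M k) * endCount T k ω} with hL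
  have hd : (0 : ℝ) ≤ d := d.cast_nonneg
  have bU : law.real U ≤ Real.exp (-(ε ^ 3 * d)) * law.real A := by
    refine (law_exists_tilt_ge_le hM1 hT d (by rw [abs_of_pos (by positivity)]; linarith) _).trans ?_
    gcongr
    nlinarith [mul_nonneg (mul_nonneg (mul_nonneg hε.le hε.le) hd) (sub_nonneg.2 hε1),
      mul_nonneg (mul_nonneg hε.le hε.le) hd]
  have bL : law.real L ≤ Real.exp (-(ε ^ 3 * d)) * law.real A := by
    refine (law_exists_tilt_ge_le hM1 hT d
      (by rw [abs_neg, abs_of_pos (by positivity)]; linarith) _).trans ?_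
    gcongr
    nlinarith [mul_nonneg (mul_nonneg (mul_nonneg hε.le hε.le) hd) (sub_nonneg.2 hε1),
      mul_nonneg (mul_nonneg hε.le hε.le) hd]
  have cover : A ⊆ (A ∩ G) ∪ (U ∪ L) := by
    intro ω hω
    by_cases hg : ω ∈ G
    · exact Or.inl ⟨hω, hg⟩
    right
    simp only [hG, Set.mem_ofPred_eq, not_forall] at hg
    obtain ⟨n, hn, hnot⟩ := hg
    have hk : M ≤ n * m := hM ▸ Nat.mul_le_mul_right m hn
    have hsqrt : Real.sqrt ((n : ℝ) / t) = Real.sqrt (((n * m : ℕ) : ℝ) / M) := by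
      rw [hM]; push_cast
      rw [mul_div_mul_right _ _ (by positivity)]
    have hu := decay_pos hk
    have hY : (0 : ℝ) ≤ endCount T (n * m) ω := Nat.cast_nonneg _
    -- The quadratic correction is nonnegative for either sign of `l`, so dropping it is safe in
    -- both tails.
    have htilt : ∀ l : ℝ, l * (decay M (n * m) * endCount T (n * m) ω) ≤
        tilt l (decay M (n * m)) * endCount T (n * m) ω := by
      intro l
      rw [tilt, add_mul, ← mul_assoc]
      have : 0 ≤ 2 * l ^ 2 * decay M (n * m) ^ 2 * endCount T (n * m) ω := by positivity
      linarith
    rw [not_and_or, not_lt, not_lt, hsqrt] at hnot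
    rcases hnot with h | h
    · refine Or.inr ⟨hω, n * m, hk, le_trans ?_ (htilt _)⟩
      have h1 : decay M (n * m) * endCount T (n * m) ω ≤ (1 - ε / 2) * d := by
        calc _ ≤ decay M (n * m) * ((1 - ε) * Real.sqrt (((n * m : ℕ) : ℝ) / M) * d) := by gcongr
          _ = (1 - ε) * (decay M (n * m) * Real.sqrt (((n * m : ℕ) : ℝ) / M)) * d := by ring
          _ ≤ _ := by
            gcongr
            exact decay_mul_sqrt_le hM1 hk (by linarith) hMε
      nlinarith
    · refine Or.inl ⟨hω, n * m, hk, le_trans ?_ (htilt _)⟩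
      refine mul_le_mul_of_nonneg_left ?_ (by positivity)
      calc (1 + ε) * d = 1 * ((1 + ε) * d) := by ring
        _ ≤ (decay M (n * m) * Real.sqrt (((n * m : ℕ) : ℝ) / M)) * ((1 + ε) * d) := by
          gcongr
          exact one_le_decay_mul_sqrt hM1 hk
        _ = decay M (n * m) * ((1 + ε) * Real.sqrt (((n * m : ℕ) : ℝ) / M) * d) := by ring
        _ ≤ _ := by gcongr
  have mA : MeasurableSet A := by
    obtain ⟨k, rfl⟩ : ∃ k, M = k + 1 := ⟨M - 1, by omega⟩
    exact (measurable_of_dependsOn (dependsOn_endCount T (k + 1))) (measurableSet_singleton d)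
  have hApos : 0 < law.real A := ENNReal.toReal_pos hA0 (measure_ne_top _ _)
  have hmain : law.real A ≤
      law.real (A ∩ G) + (law.real U + law.real L) :=
    (measureReal_mono cover).trans ((measureReal_union_le _ _).trans
      (by gcongr; exact measureReal_union_le _ _))
  -- The logarithm only has to absorb the factor 2 from the two tails.
  have hlog : 2 ≤ Real.log (15 * t) := by
    rw [Real.le_log_iff_exp_le (by positivity)]
    have : Real.exp 2 = Real.exp 1 * Real.exp 1 := by rw [← Real.exp_add]; norm_num
    nlinarith [Real.exp_one_lt_d9, Real.exp_pos 1]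
  have hreal : (ProbabilityTheory.cond law A).real G = (law.real A)⁻¹ * law.real (A ∩ G) :=
    by rw [measureReal_def, cond_apply mA, ENNReal.toReal_mul, ENNReal.toReal_inv]; rfl
  rw [hreal, inv_mul_eq_div, le_div_iff₀ hApos]
  nlinarith [mul_le_mul_of_nonneg_right hlog
    (mul_nonneg (Real.exp_pos (-(ε ^ 3 * d))).le hApos.le)]
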